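/- Let $P$ be a (nondegenerate) parallelogram in the Euclidean plane with side lengths $\ell \ge s > 0$, let $A = \ell/s$ be its aspect ratio and let $\theta_0 \in (0,\pi/2]$ be the non-obtuse angle between its long and its short side. Let $\mathcal P$ be a finite set of points in the plane in general position with respect to $P$: no four points of $\mathcal P$ lie on the boundary of a scaled translate of $P$, and no two points of $\mathcal P$ lie on a line parallel to a side of $P$. The parallelogram Delaunay graph of $\mathcal P$ is the graph with vertex set $\mathcal P$ in which distinct vertices $a,b$ are joined by an edge, of length the Euclidean distance $d_2(a,b)$, if and only if there is a scaled translate of $P$ (by a positive factor, without rotation) with $a$ and $b$ on its boundary and with no point of $\mathcal P$ in its interior. Put $$h = \frac{\sqrt{2}\,\sqrt{1+A^2+2A\cos\theta_0+(A+\cos\theta_0)\sqrt{1+A^2+2A\cos\theta_0}}}{\sin\theta_0}.$$ Then this graph is an $h$-spanner, that is, any two vertices $a,b$ are joined by a path in it of total Euclidean length at most $h\, d_2(a,b)$; in other words, its spanning ratio (the smallest $c \ge 0$ for which it is a $c$-spanner) is at most $h$. -/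

import Mathlib

open scoped NNReal ENNReal

noncomputable section

/-- The Euclidean plane. -/
abbrev Plane : Type := EuclideanSpace ℝ (Fin 2)

/-- A nondegenerate parallelogram with vertices `corner`, `corner + long`, `corner + short` and
`corner + long + short`.  The two sides are named so that `long` is at least as long as `short`
(equality is allowed). -/
structure Parallelogram where
  corner : Plane
  long : Plane
  short : Plane
  linearIndependent : LinearIndependent ℝ ![long, short]
  norm_short_le : ‖short‖ ≤ ‖long‖

namespace Parallelogram

/-- The (closed, filled) parallelogram as a set of points. -/
def carrier (P : Parallelogram) : Set Plane :=
  {x | ∃ α ∈ Set.Icc (0 : ℝ) 1, ∃ β ∈ Set.Icc (0 : ℝ) 1,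
    x = P.corner + α • P.long + β • P.short}

/-- The scaled translate `r • P + t`; it is used for scaling factors `r > 0` only. -/
def scaledTranslate (P : Parallelogram) (r : ℝ) (t : Plane) : Set Plane :=
  (fun x => r • x + t) '' P.carrier

/-- The aspect ratio: long side over short side. -/
def aspectRatio (P : Parallelogram) : ℝ := ‖P.long‖ / ‖P.short‖

/-- The non-obtuse angle between the long side and the short side. -/
def nonObtuseAngle (P : Parallelogram) : ℝ :=
  min (InnerProductGeometry.angle P.long P.short)
    (Real.pi - InnerProductGeometry.angle P.long P.short)

/-- General position with respect to `P`: no four points of `S` lie on the boundary of a scaled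
translate of `P`, and no two points of `S` lie on a line parallel to a side of `P`. -/
def GeneralPosition (P : Parallelogram) (S : Finset Plane) : Prop :=
  (∀ r : ℝ, 0 < r → ∀ t : Plane, ∀ Q : Finset Plane, Q ⊆ S → Q.card = 4 →
    ¬ ((Q : Set Plane) ⊆ frontier (P.scaledTranslate r t))) ∧
  (∀ a ∈ S, ∀ b ∈ S, a ≠ b → ∀ m : ℝ, b - a ≠ m • P.long ∧ b - a ≠ m • P.short)

/-- The parallelogram Delaunay graph of `S` with respect to `P`: distinct points `a`, `b` of `S`
are adjacent if and only if some scaled translate of `P` has both on its boundary and has no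
point of `S` in its interior. -/
def delaunayGraph (P : Parallelogram) (S : Finset Plane) : SimpleGraph S where
  Adj a b := a ≠ b ∧ ∃ r : ℝ, 0 < r ∧ ∃ t : Plane,
    (a : Plane) ∈ frontier (P.scaledTranslate r t) ∧
    (b : Plane) ∈ frontier (P.scaledTranslate r t) ∧
    ∀ c ∈ S, c ∉ interior (P.scaledTranslate r t)
  symm := ⟨fun _ _ ⟨hne, r, hr, t, ha, hb, hc⟩ => ⟨hne.symm, r, hr, t, hb, ha, hc⟩⟩
  loopless := ⟨fun _ h => h.1 rfl⟩

end Parallelogram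

/-- The length of a walk in a geometric graph: the sum of the Euclidean lengths of its edges. -/
def euclideanLength {S : Finset Plane} {G : SimpleGraph S} {a b : S} (p : G.Walk a b) : ℝ :=
  (p.darts.map fun d => dist (d.fst : Plane) (d.snd : Plane)).sum

/-- A geometric graph is a `c`-spanner if any two vertices `a`, `b` are joined by a path of length
at most `c` times the Euclidean distance of `a` and `b`. -/
def IsSpanner {S : Finset Plane} (G : SimpleGraph S) (c : ℝ) : Prop :=
  ∀ a b : S, ∃ p : G.Walk a b, p.IsPath ∧ euclideanLength p ≤ c * dist (a : Plane) (b : Plane)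

/-- The spanning ratio of a geometric graph: the least `c ≥ 0` for which it is a `c`-spanner, and
`∞` if there is none. -/
def spanningRatio {S : Finset Plane} (G : SimpleGraph S) : ℝ≥0∞ :=
  ⨅ c : ℝ≥0, ⨅ _ : IsSpanner G c, (c : ℝ≥0∞)

end

namespace SquareDelaunay

variable {ι : Type*}

/-- The open square with lower left corner `(L, B)` and side `r` contains no point `(X k, Y k)`. -/
def EmptySquare (X Y : ι → ℝ) (L B r : ℝ) : Prop :=
  ∀ k, L < X k → X k < L + r → B < Y k → Y k < B + r → False

/-- The point `(X i, Y i)` lies in the closed square with lower left corner `(L, B)` and side `r`. -/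
def InSquare (X Y : ι → ℝ) (L B r : ℝ) (i : ι) : Prop :=
  L ≤ X i ∧ X i ≤ L + r ∧ B ≤ Y i ∧ Y i ≤ B + r

/-- Adjacency in the Delaunay graph of axis-parallel squares. -/
def SquareAdj (X Y : ι → ℝ) (i j : ι) : Prop :=
  i ≠ j ∧ ∃ L B r, 0 < r ∧ InSquare X Y L B r i ∧ InSquare X Y L B r j ∧ EmptySquare X Y L B r

/-- The upper bound for the length of an edge that the argument uses. -/
def edgeWeight (X Y : ι → ℝ) (D : ℝ) (i j : ι) : ℝ :=
  min (|X i - X j| + |Y i - Y j|) (D * max |X i - X j| |Y i - Y j|)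

/-- `i` and `j` are joined by a walk of weight at most `t`. -/
inductive JoinedWithin (X Y : ι → ℝ) (D : ℝ) : ι → ι → ℝ → Prop
  | refl (i : ι) (t : ℝ) : 0 ≤ t → JoinedWithin X Y D i i t
  | cons (i j k : ι) (s t : ℝ) : SquareAdj X Y i j → JoinedWithin X Y D j k s →
      edgeWeight X Y D i j + s ≤ t → JoinedWithin X Y D i k t

/-- The bound for the walks between `i` and `j`. -/
def detour (X Y : ι → ℝ) (D : ℝ) (i j : ι) : ℝ :=
  (1 + D) * max |X i - X j| |Y i - Y j| + min |X i - X j| |Y i - Y j|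

section Basic

variable {X Y : ι → ℝ} {D : ℝ}

lemma JoinedWithin.mono {i j : ι} {s t : ℝ} (h : JoinedWithin X Y D i j s) (hst : s ≤ t) :
    JoinedWithin X Y D i j t := by
  cases h with
  | refl _ _ h0 => exact .refl _ _ (h0.trans hst)
  | cons _ j _ s' _ h1 h2 h3 => exact .cons _ j _ s' _ h1 h2 (h3.trans hst)

lemma JoinedWithin.trans {i j k : ι} {s t : ℝ} (h : JoinedWithin X Y D i j s)
    (h' : JoinedWithin X Y D j k t) : JoinedWithin X Y D i k (s + t) := by
  induction h with
  | refl _ _ h0 => exact h'.mono (by linarith)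
  | cons _ j _ s' _ h1 _ h3 ih => exact .cons _ j _ _ _ h1 (ih h') (by linarith)

lemma SquareAdj.joinedWithin {i j : ι} (h : SquareAdj X Y i j) {t : ℝ}
    (ht : edgeWeight X Y D i j ≤ t) : JoinedWithin X Y D i j t :=
  .cons _ _ _ 0 _ h (.refl _ _ le_rfl) (by linarith)

lemma SquareAdj.joinedWithin_add {i j : ι} (h : SquareAdj X Y i j) {t : ℝ}
    (ht : |X i - X j| + |Y i - Y j| ≤ t) : JoinedWithin X Y D i j t :=
  h.joinedWithin ((min_le_left _ _).trans ht)

lemma SquareAdj.joinedWithin_max {i j : ι} (h : SquareAdj X Y i j) {t : ℝ}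
    (ht : D * max |X i - X j| |Y i - Y j| ≤ t) : JoinedWithin X Y D i j t :=
  h.joinedWithin ((min_le_right _ _).trans ht)

lemma SquareAdj.swap {i j : ι} (h : SquareAdj X Y i j) : SquareAdj Y X i j := by
  obtain ⟨h0, L, B, r, h1, ⟨a1, a2, a3, a4⟩, ⟨b1, b2, b3, b4⟩, h4⟩ := h
  exact ⟨h0, B, L, r, h1, ⟨a3, a4, a1, a2⟩, ⟨b3, b4, b1, b2⟩,
    fun k k1 k2 k3 k4 => h4 k k3 k4 k1 k2⟩

lemma EmptySquare.reflect {L B r : ℝ} (h : EmptySquare X Y L B r) :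
    EmptySquare X (-Y) L (-B - r) r := by
  intro k k1 k2 k3 k4
  simp only [Pi.neg_apply] at k3 k4
  exact h k k1 k2 (by linarith) (by linarith)

lemma InSquare.reflect {L B r : ℝ} {i : ι} (h : InSquare X Y L B r i) :
    InSquare X (-Y) L (-B - r) r i := by
  obtain ⟨h1, h2, h3, h4⟩ := h
  refine ⟨h1, h2, ?_, ?_⟩ <;> simp only [Pi.neg_apply] <;> linarith

lemma SquareAdj.reflect {i j : ι} (h : SquareAdj X Y i j) : SquareAdj X (-Y) i j := by
  obtain ⟨h0, L, B, r, h1, h2, h3, h4⟩ := h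
  exact ⟨h0, L, -B - r, r, h1, h2.reflect, h3.reflect, h4.reflect⟩

lemma abs_neg_sub_neg_apply (i j : ι) : |(-Y) i - (-Y) j| = |Y i - Y j| := by
  rw [Pi.neg_apply, Pi.neg_apply, neg_sub_neg, abs_sub_comm]

lemma JoinedWithin.swap {i j : ι} {t : ℝ} (h : JoinedWithin X Y D i j t) :
    JoinedWithin Y X D i j t := by
  induction h with
  | refl _ _ h0 => exact .refl _ _ h0
  | cons _ j _ s _ h1 _ h3 ih =>
    refine .cons _ j _ s _ h1.swap ih ?_
    rwa [edgeWeight, add_comm |_|, max_comm]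

lemma JoinedWithin.reflect {i j : ι} {t : ℝ} (h : JoinedWithin X Y D i j t) :
    JoinedWithin X (-Y) D i j t := by
  induction h with
  | refl _ _ h0 => exact .refl _ _ h0
  | cons _ j _ s _ h1 _ h3 ih =>
    refine .cons _ j _ s _ h1.reflect ih ?_
    rwa [edgeWeight, abs_neg_sub_neg_apply]

lemma JoinedWithin.of_reflect {i j : ι} {t : ℝ} (h : JoinedWithin X (-Y) D i j t) :
    JoinedWithin X Y D i j t := by
  simpa using h.reflect

lemma detour_swap (i j : ι) : detour Y X D i j = detour X Y D i j := by
  rw [detour, detour, max_comm, min_comm]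

lemma detour_reflect (i j : ι) : detour X (-Y) D i j = detour X Y D i j := by
  rw [detour, detour, abs_neg_sub_neg_apply]

end Basic

section Walks

variable {X Y : ι → ℝ} {D : ℝ} {b : ι}

/-- All points closer to `b` than `ρ` in the maximum metric are joined to `b` by short walks. -/
def ShortNear (X Y : ι → ℝ) (D : ℝ) (b : ι) (ρ : ℝ) : Prop :=
  ∀ c, max |X c - X b| |Y c - Y b| < ρ → JoinedWithin X Y D c b (detour X Y D c b)

lemma ShortNear.reflect {ρ : ℝ} (h : ShortNear X Y D b ρ) : ShortNear X (-Y) D b ρ := by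
  intro c hc
  rw [abs_neg_sub_neg_apply] at hc
  rw [detour_reflect]
  exact (h c hc).reflect

variable [Finite ι]

/-- The induction principle for points ordered by decreasing abscissa. -/
lemma induction_right (X : ι → ℝ) {p : ι → Prop} (h : ∀ i, (∀ j, X i < X j → p j) → p i) (i : ι) :
    p i := by
  have : IsTrans ι (fun j i => X i < X j) := ⟨fun _ _ _ h1 h2 => h2.trans h1⟩
  have : Std.Irrefl (fun j i : ι => X i < X j) := ⟨fun _ => lt_irrefl _⟩
  exact (Finite.wellFounded_of_trans_of_irrefl (fun j i : ι => X i < X j)).induction i h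

lemma joinedWithin_of_empty_left_above (hX : X.Injective) (hY : Y.Injective) (hD : 1 ≤ D) {ρ : ℝ}
    (hb : ShortNear X Y D b ρ) (c : ι) (hcb : X c ≤ X b) (hρ : X b - X c < ρ) (hbc : Y b ≤ Y c)
    (he : EmptySquare X Y (X c - (Y c - Y b)) (Y b) (Y c - Y b)) :
    JoinedWithin X Y D c b ((1 + D) * (X b - X c) + (Y c - Y b)) := by
  induction c using induction_right X with
  | h c ih =>
  rcases eq_or_ne c b with rfl | hne
  · exact .refl _ _ (by simp)
  have hlt : Y b < Y c := lt_of_le_of_ne hbc fun h => hne (hY h).symm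
  have hltx : X c < X b := lt_of_le_of_ne hcb fun h => hne (hX h)
  have ax : |X c - X b| = X b - X c := by rw [abs_sub_comm, abs_of_pos (by linarith)]
  have ay : |Y c - Y b| = Y c - Y b := abs_of_pos (by linarith)
  rcases le_or_gt (Y c - Y b) (X b - X c) with hg | hs
  · have := hb c (by rw [ax, ay, max_eq_left hg]; exact hρ)
    rwa [detour, ax, ay, max_eq_left hg, min_eq_right hg] at this
  obtain ⟨d, ⟨hd1, hd2, hd3⟩, hmin⟩ := Set.exists_min_image
    {k | Y b ≤ Y k ∧ Y k < Y c ∧ X c < X k} X (Set.toFinite _) ⟨b, le_rfl, hlt, hltx⟩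
  have hdb : X d ≤ X b := hmin b ⟨le_rfl, hlt, hltx⟩
  have he' : EmptySquare X Y (X d - (Y c - Y b)) (Y b) (Y c - Y b) := by
    intro k k1 k2 k3 k4
    rcases lt_or_ge (X c) (X k) with h | h
    · have := hmin k ⟨k3.le, by linarith, h⟩
      linarith
    · refine he k (by linarith) ?_ k3 k4
      have : X k ≠ X c := fun h => by
        have := hX h
        subst this
        linarith
      have := lt_of_le_of_ne h this
      linarith
  have hadj : SquareAdj X Y c d := by
    refine ⟨fun h => by subst h; linarith, _, _, _, by linarith, ?_, ?_, he'⟩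
    · exact ⟨by linarith, by linarith, by linarith, by linarith⟩
    · exact ⟨by linarith, by linarith, by linarith, by linarith⟩
  have h1 : JoinedWithin X Y D c d ((X d - X c) + (Y c - Y d)) := by
    apply hadj.joinedWithin_add
    rw [abs_of_neg (by linarith), abs_of_pos (by linarith)]
    linarith
  refine (h1.trans (ih d hd3 hdb (by linarith) hd1 ?_)).mono ?_
  · intro k k1 k2 k3 k4
    exact he' k (by linarith) (by linarith) k3 (by linarith)
  · nlinarith

/-- If an empty square has `c` on its right side and reaches the height of `b`, which lies further
right, then `c` and `b` are joined by a short walk. -/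
lemma joinedWithin_of_empty_left (hX : X.Injective) (hY : Y.Injective) (hD : 1 ≤ D) {ρ : ℝ}
    (hb : ShortNear X Y D b ρ) {c : ι} {L B r : ℝ} (he : EmptySquare X Y L B r)
    (hc : X c = L + r) (hcb : X c ≤ X b) (hρ : X b - X c < ρ)
    (h1 : B ≤ Y c) (h2 : Y c ≤ B + r) (h3 : B ≤ Y b) (h4 : Y b ≤ B + r) :
    JoinedWithin X Y D c b ((1 + D) * (X b - X c) + |Y c - Y b|) := by
  rcases le_total (Y b) (Y c) with h | h
  · rw [abs_of_nonneg (by linarith)]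
    refine joinedWithin_of_empty_left_above hX hY hD hb c hcb hρ h ?_
    intro k k1 k2 k3 k4
    exact he k (by linarith) (by linarith) (by linarith) (by linarith)
  · rw [abs_of_nonpos (by linarith)]
    have := (joinedWithin_of_empty_left_above (Y := -Y) hX (neg_injective.comp hY) hD hb.reflect c
      hcb hρ (by simpa using h) (by
        intro k k1 k2 k3 k4
        simp only [Pi.neg_apply] at k1 k2 k3 k4
        exact he k (by linarith) (by linarith) (by linarith) (by linarith))).of_reflect
    refine this.mono (le_of_eq ?_)
    simp only [Pi.neg_apply]
    ring

end Walks
/-- Two points `h` and `l` right of `a`, above and below the strip of `a` and `b`, that walks from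
`a` of weights `s` and `t` reach. -/
structure Bracket (X Y : ι → ℝ) (D : ℝ) (a b h l : ι) (s t : ℝ) : Prop where
  joined_h : JoinedWithin X Y D a h s
  joined_l : JoinedWithin X Y D a l t
  left_h : X a ≤ X h
  left_l : X a ≤ X l
  above_a : Y a ≤ Y h
  above_b : Y b < Y h
  below_a : Y l ≤ Y a
  below_b : Y l < Y b
  bound_h : s ≤ 2 * (X h - X a) + (Y h - min (Y a) (Y b))
  bound_l : t ≤ 2 * (X l - X a) + (max (Y a) (Y b) - Y l)

/-- A steep bracket together with an empty square between the heights of `l` and `h`, with right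
side at abscissa `R`, such that `h` and `l` are on its boundary. -/
structure Front (X Y : ι → ℝ) (D : ℝ) (a b h l : ι) (R s t : ℝ) : Prop
    extends Bracket X Y D a b h l s t where
  le_h : R - (Y h - Y l) ≤ X h
  le_l : R - (Y h - Y l) ≤ X l
  h_le : X h ≤ R
  l_le : X l ≤ R
  le_b : R ≤ X b
  empty : EmptySquare X Y (R - (Y h - Y l)) (Y l) (Y h - Y l)
  potential : s + t + (2 * R - X h - X l) + (Y h - Y l) ≤ 4 * (R - X a)

/-- The goal of the sweep from `a` to `b`. -/
def ShortWalk (X Y : ι → ℝ) (D : ℝ) (a b : ι) : Prop :=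
  JoinedWithin X Y D a b ((1 + D) * (X b - X a) + |Y b - Y a|)

section Reflect

variable {X Y : ι → ℝ} {D : ℝ} {a b h l : ι} {R s t : ℝ}

lemma ShortWalk.of_reflect (hw : ShortWalk X (-Y) D a b) : ShortWalk X Y D a b := by
  have := JoinedWithin.of_reflect hw
  rwa [abs_neg_sub_neg_apply] at this

lemma Bracket.reflect (hf : Bracket X Y D a b h l s t) : Bracket X (-Y) D a b l h t s where
  joined_h := hf.joined_l.reflect
  joined_l := hf.joined_h.reflect
  left_h := hf.left_l
  left_l := hf.left_h
  above_a := by simpa using hf.below_a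
  above_b := by simpa using hf.below_b
  below_a := by simpa using hf.above_a
  below_b := by simpa using hf.above_b
  bound_h := by
    have := hf.bound_l
    simp only [Pi.neg_apply, min_neg_neg]
    linarith
  bound_l := by
    have := hf.bound_h
    simp only [Pi.neg_apply, max_neg_neg]
    linarith

lemma Front.reflect (hf : Front X Y D a b h l R s t) : Front X (-Y) D a b l h R t s := by
  have e : (-Y) l - (-Y) h = Y h - Y l := by simp only [Pi.neg_apply]; ring
  refine ⟨hf.toBracket.reflect, ?_, ?_, hf.l_le, hf.h_le, hf.le_b, ?_, ?_⟩
  · rw [e]; exact hf.le_l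
  · rw [e]; exact hf.le_h
  · rw [e]
    convert hf.empty.reflect using 1
    simp only [Pi.neg_apply]; ring
  · rw [e]
    linarith [hf.potential]

end Reflect

section Sweep

variable {X Y : ι → ℝ} {D : ℝ} {a b h l : ι} {s t : ℝ}

/-- The weight of the better of the two walks from `a` through `h` and `l` to a point `c` on the
right side of an empty square with `h` and `l` on its boundary. -/
lemma Bracket.exists_joinedWithin_right (hf : Bracket X Y D a b h l s t) {c : ι} {L B r : ℝ}
    (hr : 0 < r) (he : EmptySquare X Y L B r) (hh : InSquare X Y L B r h)
    (hl : InSquare X Y L B r l) (hc : InSquare X Y L B r c) (hcr : X c = L + r)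
    (hch : c ≠ h) (hcl : c ≠ l)
    (hpot : s + t + (2 * X c - X h - X l) + (B + r - Y h) + (Y l - B) + r ≤ 4 * (X c - X a)) :
    ∃ u, JoinedWithin X Y D a c u ∧ u ≤ 2 * (X c - X a) ∧
      u ≤ s + (X c - X h) + (B + r - Y h) + (B + r - Y c) ∧
      u ≤ t + (X c - X l) + (Y l - B) + (Y c - B) := by
  obtain ⟨h1, h2, h3, h4⟩ := hh
  obtain ⟨l1, l2, l3, l4⟩ := hl
  obtain ⟨c1, c2, c3, c4⟩ := hc
  have ph : JoinedWithin X Y D a c (s + ((X c - X h) + (B + r - Y h) + (B + r - Y c))) := by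
    refine hf.joined_h.trans (SquareAdj.joinedWithin_add ⟨hch.symm, L, B, r, hr,
      ⟨h1, h2, h3, h4⟩, ⟨c1, c2, c3, c4⟩, he⟩ ?_)
    have : |Y h - Y c| ≤ (B + r - Y h) + (B + r - Y c) := abs_le.2 ⟨by linarith, by linarith⟩
    rw [abs_of_nonpos (by linarith : X h - X c ≤ 0)]
    linarith
  have pl : JoinedWithin X Y D a c (t + ((X c - X l) + (Y l - B) + (Y c - B))) := by
    refine hf.joined_l.trans (SquareAdj.joinedWithin_add ⟨hcl.symm, L, B, r, hr,
      ⟨l1, l2, l3, l4⟩, ⟨c1, c2, c3, c4⟩, he⟩ ?_)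
    have : |Y l - Y c| ≤ (Y l - B) + (Y c - B) := abs_le.2 ⟨by linarith, by linarith⟩
    rw [abs_of_nonpos (by linarith : X l - X c ≤ 0)]
    linarith
  rcases le_total (s + ((X c - X h) + (B + r - Y h) + (B + r - Y c)))
    (t + ((X c - X l) + (Y l - B) + (Y c - B))) with hle | hle
  · exact ⟨_, ph, by linarith, by linarith, by linarith⟩
  · exact ⟨_, pl, by linarith, by linarith, by linarith⟩

variable [Finite ι]

lemma Bracket.shortWalk_of_right_above (hX : X.Injective) (hY : Y.Injective) (hD : 1 ≤ D)
    (hb : ShortNear X Y D b (X b - X a)) (hf : Bracket X Y D a b h l s t) {c : ι} {L B r : ℝ}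
    (hr : 0 < r) (he : EmptySquare X Y L B r) (hh : InSquare X Y L B r h)
    (hl : InSquare X Y L B r l) (hc : InSquare X Y L B r c) (hcr : X c = L + r)
    (hch : X h < X c) (hcl : X l < X c) (hcb : X c ≤ X b)
    (hpot : s + t + (2 * X c - X h - X l) + (B + r - Y h) + (Y l - B) + r ≤ 4 * (X c - X a))
    (hca : Y a ≤ Y c) (hcb' : Y b < Y c)
    (next : ∀ h' l', X h + X l < X h' + X l' →
      ∀ R s' t', Front X Y D a b h' l' R s' t' → ShortWalk X Y D a b) :
    ShortWalk X Y D a b := by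
  obtain ⟨u, hu, hu1, hu2, -⟩ := hf.exists_joinedWithin_right hr he hh hl hc hcr
    (fun h => by subst h; exact hch.false) (fun h => by subst h; exact hcl.false) hpot
  have hla := hf.left_l
  have hya := hf.below_a
  have hyb := hf.below_b
  have hba := hf.above_a
  have hbb := hf.above_b
  have hbl := hf.bound_l
  have m1 := min_le_left (Y a) (Y b)
  obtain ⟨h1, h2, h3, h4⟩ := id hh
  obtain ⟨l1, l2, l3, l4⟩ := id hl
  obtain ⟨c1, c2, c3, c4⟩ := id hc
  rcases le_or_gt (Y c - Y l) (X c - X l) with hg | hs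
  · have p1 : JoinedWithin X Y D l c (D * (X c - X l)) := by
      refine SquareAdj.joinedWithin_max ⟨fun h => by subst h; exact hcl.false,
        L, B, r, hr, hl, hc, he⟩ ?_
      rw [abs_of_neg (by linarith), abs_of_neg (by linarith), max_eq_left (by linarith)]
      linarith
    have p2 := joinedWithin_of_empty_left hX hY hD hb he hcr hcb (by linarith) c3 c4
      (by linarith) (by linarith)
    refine ((hf.joined_l.trans p1).trans p2).mono ?_
    rw [abs_of_pos (by linarith : 0 < Y c - Y b)]
    have m2 : max (Y a) (Y b) - Y b ≤ |Y b - Y a| := by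
      rw [← max_sub_min_eq_abs]
      linarith [min_le_right (Y a) (Y b)]
    have := mul_nonneg (sub_nonneg.2 hD) (sub_nonneg.2 hla)
    linarith
  · refine next c l (by linarith) (X c) u t ⟨⟨hu, hf.joined_l, by linarith, hla, hca, hcb',
      hya, hyb, by linarith, hbl⟩, by linarith, by linarith, le_rfl, hcl.le, hcb, ?_, ?_⟩
    · intro k k1 k2 k3 k4
      exact he k (by linarith) (by linarith) (by linarith) (by linarith)
    · linarith

/-- The sweep meets a point `c` on the right side of the square. -/
lemma Bracket.shortWalk_of_right (hX : X.Injective) (hY : Y.Injective) (hD : 1 ≤ D)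
    (hb : ShortNear X Y D b (X b - X a)) (hf : Bracket X Y D a b h l s t) {c : ι} {L B r : ℝ}
    (hr : 0 < r) (he : EmptySquare X Y L B r) (hh : InSquare X Y L B r h)
    (hl : InSquare X Y L B r l) (hc : InSquare X Y L B r c) (hcr : X c = L + r)
    (hch : X h < X c) (hcl : X l < X c) (hcb : X c ≤ X b)
    (hpot : s + t + (2 * X c - X h - X l) + (B + r - Y h) + (Y l - B) + r ≤ 4 * (X c - X a))
    (next : ∀ h' l', X h + X l < X h' + X l' →
      ∀ R s' t', Front X Y D a b h' l' R s' t' → ShortWalk X Y D a b) :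
    ShortWalk X Y D a b := by
  by_cases hup : Y a ≤ Y c ∧ Y b < Y c
  · exact hf.shortWalk_of_right_above hX hY hD hb hr he hh hl hc hcr hch hcl hcb hpot hup.1 hup.2
      next
  by_cases hdown : Y c ≤ Y a ∧ Y c < Y b
  · refine ShortWalk.of_reflect (hf.reflect.shortWalk_of_right_above hX (neg_injective.comp hY) hD
      hb.reflect hr he.reflect hl.reflect hh.reflect hc.reflect hcr hcl hch hcb ?_
      (by simpa using hdown.1) (by simpa using hdown.2) ?_)
    · simp only [Pi.neg_apply]
      linarith
    · intro h' l' hlt R s' t' hf'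
      have := hf'.reflect
      rw [neg_neg] at this
      have hw := next l' h' (by linarith) R t' s' this
      refine ShortWalk.of_reflect ?_
      rwa [neg_neg]
  obtain ⟨u, hu, hu1, -, -⟩ := hf.exists_joinedWithin_right hr he hh hl hc hcr
    (fun h => by subst h; exact hch.false) (fun h => by subst h; exact hcl.false) hpot
  have hla := hf.left_l
  have hya := hf.below_a
  have hyb := hf.below_b
  have hba := hf.above_a
  have hbb := hf.above_b
  obtain ⟨h1, h2, h3, h4⟩ := id hh
  obtain ⟨l1, l2, l3, l4⟩ := id hl
  obtain ⟨c1, c2, c3, c4⟩ := id hc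
  have p2 := joinedWithin_of_empty_left hX hY hD hb he hcr hcb (by linarith) c3 c4
    (by linarith) (by linarith)
  refine (hu.trans p2).mono ?_
  have m : |Y c - Y b| ≤ |Y b - Y a| := by
    rcases le_total (Y a) (Y b) with hab | hab
    · rw [abs_of_nonneg (by linarith : 0 ≤ Y b - Y a)]
      refine abs_le.2 ⟨?_, ?_⟩ <;> by_contra! hcon
      · exact hdown ⟨by linarith, by linarith⟩
      · exact hup ⟨by linarith, by linarith⟩
    · rw [abs_of_nonpos (by linarith : Y b - Y a ≤ 0)]
      refine abs_le.2 ⟨?_, ?_⟩ <;> by_contra! hcon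
      · exact hdown ⟨by linarith, by linarith⟩
      · exact hup ⟨by linarith, by linarith⟩
  have := mul_nonneg (sub_nonneg.2 hD) (sub_nonneg.2 (by linarith : X a ≤ X c))
  linarith

/-- The part of the sweep in which the square has become blocked by `h` on its left and grows from
its lower left corner. -/
lemma Front.shortWalk_of_grow (hX : X.Injective) (hY : Y.Injective) (hD : 1 ≤ D) {R : ℝ}
    (hb : ShortNear X Y D b (X b - X a)) (hf : Front X Y D a b h l R s t) (hhl : X h < X l)
    (hslab : ∀ k, Y l < Y k → Y k < Y h → X h < X k → X h + (Y h - Y l) < X k)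
    (next : ∀ h' l', X h + X l < X h' + X l' →
      ∀ R s' t', Front X Y D a b h' l' R s' t' → ShortWalk X Y D a b) :
    ShortWalk X Y D a b := by
  have hlea := hf.left_h
  have hya := hf.below_a
  have hyb := hf.below_b
  have hba := hf.above_a
  have hbb := hf.above_b
  have g1 := hf.le_h
  have g3 := hf.h_le
  have g4 := hf.l_le
  have g5 := hf.le_b
  have gp := hf.potential
  have hXb : X h < X b := lt_of_lt_of_le (hhl.trans_le g4) g5
  obtain ⟨c, ⟨hc1, hc2⟩, hmin⟩ := Set.exists_min_image {k | X h < X k ∧ Y l < Y k}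
    (fun k => max (X k - X h) (Y k - Y l)) (Set.toFinite _) ⟨b, hXb, hyb⟩
  obtain ⟨r, hr⟩ : ∃ r, r = max (X c - X h) (Y c - Y l) := ⟨_, rfl⟩
  have hrx : X c - X h ≤ r := hr ▸ le_max_left _ _
  have hry : Y c - Y l ≤ r := hr ▸ le_max_right _ _
  have hrb : r ≤ X b - X h := by
    have := hmin b ⟨hXb, hyb⟩
    have h2 := hslab b hyb hbb hXb
    rwa [← hr, max_eq_left (by linarith : Y b - Y l ≤ X b - X h)] at this
  have hrρ : Y h - Y l ≤ r := by
    rcases lt_or_ge (Y c) (Y h) with h1 | h1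
    · linarith [hslab c hc2 h1 hc1]
    · linarith
  have he : EmptySquare X Y (X h) (Y l) r := by
    intro k k1 k2 k3 k4
    have := hmin k ⟨k1, k3⟩
    rw [← hr] at this
    exact absurd this (not_le.2 (max_lt (by linarith) (by linarith)))
  have ih : InSquare X Y (X h) (Y l) r h := ⟨le_rfl, by linarith, by linarith, by linarith⟩
  have il : InSquare X Y (X h) (Y l) r l := ⟨hhl.le, by linarith, le_rfl, by linarith⟩
  have ic : InSquare X Y (X h) (Y l) r c := ⟨hc1.le, by linarith, hc2.le, by linarith⟩
  rcases eq_or_lt_of_le hrx with hE | hN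
  · have hlc : X l < X c := by
      refine lt_of_le_of_ne (by linarith) fun h => ?_
      have := hX h
      subst this
      exact hc2.false
    exact hf.shortWalk_of_right hX hY hD hb (by linarith) he ih il ic (by linarith) hc1 hlc
      (by linarith) (by linarith) next
  · have hcy : Y c = Y l + r := by
      rcases max_choice (X c - X h) (Y c - Y l) with h1 | h1 <;> linarith
    have hhc : Y h ≤ Y c := by linarith
    have hne : h ≠ c := fun h => by subst h; exact hc1.false
    have e : Y c - Y l = r := by linarith
    have adj : JoinedWithin X Y D h c ((X c - X h) + (Y c - Y h)) := by
      refine SquareAdj.joinedWithin_add ⟨hne, _, _, r, by linarith, ih, ic, he⟩ ?_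
      rw [abs_of_neg (by linarith), abs_of_nonpos (by linarith)]
      linarith
    have hbh := hf.bound_h
    refine next c l (by linarith) (X h + r) _ t ⟨⟨hf.joined_h.trans adj, hf.joined_l, by linarith,
      hf.left_l, by linarith, by linarith, hya, hyb, by linarith, hf.bound_l⟩,
      by linarith, by linarith, by linarith, by linarith, by linarith, ?_, by linarith⟩
    rwa [e, add_sub_cancel_right]

lemma Front.shortWalk (hX : X.Injective) (hY : Y.Injective) (hD : 1 ≤ D) {R : ℝ}
    (hb : ShortNear X Y D b (X b - X a)) (hf : Front X Y D a b h l R s t) :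
    ShortWalk X Y D a b := by
  obtain ⟨p, rfl, rfl⟩ : ∃ p : ι × ι, p.1 = h ∧ p.2 = l := ⟨(h, l), rfl, rfl⟩
  induction p using induction_right (fun p : ι × ι => X p.1 + X p.2) generalizing R s t with
  | h p ih =>
  obtain ⟨h, l⟩ := p
  dsimp only at hf ih
  have next : ∀ h' l', X h + X l < X h' + X l' →
      ∀ R s' t', Front X Y D a b h' l' R s' t' → ShortWalk X Y D a b :=
    fun h' l' hlt R s' t' hf' => ih (h', l') hlt hf'
  have hya := hf.below_a
  have hyb := hf.below_b
  have hba := hf.above_a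
  have hbb := hf.above_b
  have g1 := hf.le_h
  have g2 := hf.le_l
  have g3 := hf.h_le
  have g4 := hf.l_le
  have g5 := hf.le_b
  have gp := hf.potential
  by_cases hslab : ∃ k, Y l < Y k ∧ Y k < Y h ∧ R ≤ X k ∧ X k ≤ min (X h) (X l) + (Y h - Y l)
  · obtain ⟨c, ⟨c1, c2, c3, c4⟩, hmin⟩ := Set.exists_min_image
      {k | Y l < Y k ∧ Y k < Y h ∧ R ≤ X k ∧ X k ≤ min (X h) (X l) + (Y h - Y l)} X
      (Set.toFinite _) hslab
    have m1 := min_le_left (X h) (X l)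
    have m2 := min_le_right (X h) (X l)
    have hcb : X c ≤ X b := by
      by_contra! hcon
      exact hcon.not_ge (hmin b ⟨hyb, hbb, g5, by linarith⟩)
    have hne (i : ι) (hi : i ≠ c) (hi' : X i ≤ R) : X i < X c :=
      lt_of_le_of_ne (hi'.trans c3) fun h => hi (hX h)
    refine hf.shortWalk_of_right hX hY hD hb (L := X c - (Y h - Y l)) (B := Y l) (r := Y h - Y l)
      (c := c) (by linarith) ?_ ⟨by linarith, by linarith, by linarith, by linarith⟩
      ⟨by linarith, by linarith, by linarith, by linarith⟩
      ⟨by linarith, by linarith, by linarith, by linarith⟩ (by linarith)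
      (hne h (fun h => by subst h; exact c2.false) g3)
      (hne l (fun h => by subst h; exact c1.false) g4) hcb (by linarith) next
    intro k k1 k2 k3 k4
    rcases lt_or_ge (X k) R with h1 | h1
    · exact hf.empty k (by linarith) (by linarith) k3 k4
    · have := hmin k ⟨k3, by linarith, h1, by linarith⟩
      linarith
  · push Not at hslab
    have hslab' : ∀ k, Y l < Y k → Y k < Y h → min (X h) (X l) < X k →
        min (X h) (X l) + (Y h - Y l) < X k := by
      intro k k1 k2 k3
      refine hslab k k1 k2 ?_
      by_contra! hcon
      exact hf.empty k ((le_min g1 g2).trans_lt k3) (by linarith) k1 (by linarith)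
    rcases lt_trichotomy (X h) (X l) with hlt | heq | hlt
    · rw [min_eq_left hlt.le] at hslab'
      exact hf.shortWalk_of_grow hX hY hD hb hlt hslab' next
    · have := hX heq
      subst this
      linarith
    · rw [min_eq_right hlt.le] at hslab'
      refine ShortWalk.of_reflect (hf.reflect.shortWalk_of_grow hX (neg_injective.comp hY) hD
        hb.reflect hlt ?_ ?_)
      · intro k k1 k2 k3
        simp only [Pi.neg_apply] at k1 k2 k3 ⊢
        linarith [hslab' k (by linarith) (by linarith) k3]
      · intro h' l' hlt R s' t' hf'
        have := hf'.reflect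
        rw [neg_neg] at this
        have hw := next l' h' (by linarith) R t' s' this
        refine ShortWalk.of_reflect ?_
        rwa [neg_neg]

/-- The bound for two points whose difference is in the first octant. -/
lemma shortWalk_of_octant (hX : X.Injective) (hY : Y.Injective) (hD : 1 ≤ D)
    (hb : ShortNear X Y D b (X b - X a)) (hx : X a < X b) (hy : Y a < Y b)
    (hxy : Y b - Y a ≤ X b - X a) : ShortWalk X Y D a b := by
  obtain ⟨c, ⟨hc1, hc2⟩, hmin⟩ := Set.exists_min_image {k | X a < X k ∧ Y a < Y k}
    (fun k => max (X k - X a) (Y k - Y a)) (Set.toFinite _) ⟨b, hx, hy⟩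
  obtain ⟨r, hr⟩ : ∃ r, r = max (X c - X a) (Y c - Y a) := ⟨_, rfl⟩
  have hrx : X c - X a ≤ r := hr ▸ le_max_left _ _
  have hry : Y c - Y a ≤ r := hr ▸ le_max_right _ _
  have hrb : r ≤ X b - X a := by
    have := hmin b ⟨hx, hy⟩
    rwa [← hr, max_eq_left hxy] at this
  have he : EmptySquare X Y (X a) (Y a) r := by
    intro k k1 k2 k3 k4
    have := hmin k ⟨k1, k3⟩
    rw [← hr] at this
    exact absurd this (not_le.2 (max_lt (by linarith) (by linarith)))
  have ia : InSquare X Y (X a) (Y a) r a := ⟨le_rfl, by linarith, le_rfl, by linarith⟩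
  have ic : InSquare X Y (X a) (Y a) r c := ⟨hc1.le, by linarith, hc2.le, by linarith⟩
  have adj : SquareAdj X Y a c :=
    ⟨fun h => by subst h; exact hc1.false, _, _, r, by linarith, ia, ic, he⟩
  have ax : |X a - X c| = X c - X a := by rw [abs_of_neg (by linarith), neg_sub]
  have ay : |Y a - Y c| = Y c - Y a := by rw [abs_of_neg (by linarith), neg_sub]
  have p1 : JoinedWithin X Y D a c ((X c - X a) + (Y c - Y a)) :=
    adj.joinedWithin_add (by rw [ax, ay])
  rw [ShortWalk, abs_of_pos (by linarith : 0 < Y b - Y a)]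
  rcases le_or_gt (Y c) (Y b) with hcb | hcb
  · have bx : |X c - X b| = X b - X c := by rw [abs_of_nonpos (by linarith), neg_sub]
    have hbY : |Y c - Y b| = Y b - Y c := by rw [abs_of_nonpos (by linarith), neg_sub]
    have p2 := hb c (by rw [bx, hbY]; exact max_lt (by linarith) (by linarith))
    refine (p1.trans p2).mono ?_
    rw [detour, bx, hbY]
    have h1 := mul_nonneg (by linarith : 0 ≤ D) (sub_nonneg.2 hc1.le)
    have h2 := mul_nonneg (by linarith : 0 ≤ D) (sub_nonneg.2 hc2.le)
    have h3 := mul_nonneg (by linarith : 0 ≤ D) (sub_nonneg.2 hxy)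
    rcases le_total (Y b - Y c) (X b - X c) with hle | hle
    · rw [max_eq_left hle, min_eq_right hle]
      linarith
    · rw [max_eq_right hle, min_eq_left hle]
      linarith
  · rcases le_or_gt (Y c - Y a) (X c - X a) with hg | hs
    · have hrc : r = X c - X a := by rw [hr, max_eq_left hg]
      have p2 := joinedWithin_of_empty_left hX hY hD hb he (c := c) (by linarith) (by linarith)
        (by linarith) hc2.le (by linarith) hy.le (by linarith)
      have p3 : JoinedWithin X Y D a c (D * (X c - X a)) :=
        adj.joinedWithin_max (by rw [ax, ay, max_eq_left hg])
      refine (p3.trans p2).mono ?_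
      rw [abs_of_pos (by linarith : 0 < Y c - Y b)]
      linarith
    · have hrc : Y c - Y a = r := by rw [hr, max_eq_right hs.le]
      have hf : Front X Y D a b c a (X a + r) ((X c - X a) + (Y c - Y a)) 0 := by
        refine ⟨⟨p1, .refl _ _ le_rfl, hc1.le, le_rfl, hc2.le, hcb, le_rfl, hy, ?_, ?_⟩,
          by linarith, by linarith, by linarith, by linarith, by linarith, ?_, by linarith⟩
        · linarith [min_le_left (Y a) (Y b)]
        · linarith [le_max_left (Y a) (Y b)]
        · rwa [hrc, add_sub_cancel_right]
      have := hf.shortWalk hX hY hD hb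
      rwa [ShortWalk, abs_of_pos (by linarith : 0 < Y b - Y a)] at this

lemma joinedWithin_of_shortNear (hX : X.Injective) (hY : Y.Injective) (hD : 1 ≤ D) (hab : a ≠ b)
    (hb : ShortNear X Y D b (max |X a - X b| |Y a - Y b|)) :
    JoinedWithin X Y D a b (detour X Y D a b) := by
  wlog hxy : |Y a - Y b| ≤ |X a - X b| generalizing X Y
  · have := this hY hX (fun c hc => by
      rw [detour_swap]
      exact (hb c (by rwa [max_comm, max_comm |X a - X b|])).swap) (le_of_not_ge hxy)
    rw [detour_swap] at this
    exact this.swap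
  wlog hy : Y a < Y b generalizing Y
  · have := this (Y := -Y) (neg_injective.comp hY)
      (by rw [abs_neg_sub_neg_apply]; exact hb.reflect)
      (by rwa [abs_neg_sub_neg_apply])
      (by
        have : Y a ≠ Y b := fun h => hab (hY h)
        simpa using lt_of_le_of_ne (not_lt.1 hy) this.symm)
    rw [detour_reflect] at this
    exact this.of_reflect
  wlog hx : X a < X b generalizing X
  · have := this (X := -X) (neg_injective.comp hX)
      (fun c hc => by
        rw [← detour_swap, detour_reflect, detour_swap]
        rw [abs_neg_sub_neg_apply, abs_neg_sub_neg_apply] at hc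
        exact (hb c hc).swap.reflect.swap)
      (by rwa [abs_neg_sub_neg_apply])
      (by
        have : X a ≠ X b := fun h => hab (hX h)
        simpa using lt_of_le_of_ne (not_lt.1 hx) this.symm)
    rw [← detour_swap, detour_reflect, detour_swap] at this
    exact this.swap.of_reflect.swap
  have ax : |X a - X b| = X b - X a := by rw [abs_of_neg (by linarith), neg_sub]
  have ay : |Y a - Y b| = Y b - Y a := by rw [abs_of_neg (by linarith), neg_sub]
  rw [max_eq_left hxy, ax] at hb
  rw [ax, ay] at hxy
  have := shortWalk_of_octant hX hY hD hb hx hy hxy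
  rw [ShortWalk, abs_of_pos (by linarith : 0 < Y b - Y a), ← ax, ← ay] at this
  rw [detour, max_eq_left (by rwa [ax, ay]), min_eq_right (by rwa [ax, ay])]
  exact this

/-- The square Delaunay graph of finitely many points with distinct abscissas and distinct
ordinates joins any two of them by a short walk. -/
theorem joinedWithin_detour (hX : X.Injective) (hY : Y.Injective) (hD : 1 ≤ D) (a b : ι) :
    JoinedWithin X Y D a b (detour X Y D a b) := by
  let f : ι × ι → ℝ := fun p => -max |X p.1 - X p.2| |Y p.1 - Y p.2|
  obtain ⟨p, rfl, rfl⟩ : ∃ p : ι × ι, p.1 = a ∧ p.2 = b := ⟨(a, b), rfl, rfl⟩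
  induction p using induction_right f with
  | h p ih =>
  rcases eq_or_ne p.1 p.2 with h | h
  · rw [h]
    exact .refl _ _ (by simp [detour])
  · exact joinedWithin_of_shortNear hX hY hD h fun c hc => ih (c, p.2) (neg_lt_neg hc)

end Sweep
end SquareDelaunay

lemma sum_le_sum_of_sublist {l₁ l₂ : List ℝ} (h : l₁.Sublist l₂) (h0 : ∀ x ∈ l₂, 0 ≤ x) :
    l₁.sum ≤ l₂.sum := by
  induction h with
  | slnil => exact le_rfl
  | cons a _ ih =>
    rw [List.sum_cons]
    linarith [ih fun x hx => h0 x (List.mem_cons_of_mem _ hx), h0 a List.mem_cons_self]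
  | cons_cons a _ ih =>
    rw [List.sum_cons, List.sum_cons]
    linarith [ih fun x hx => h0 x (List.mem_cons_of_mem _ hx)]

lemma euclideanLength_bypass_le {S : Finset Plane} {G : SimpleGraph S} {a b : S}
    (p : G.Walk a b) : euclideanLength p.bypass ≤ euclideanLength p := by
  refine sum_le_sum_of_sublist (p.darts_bypass_sublist_darts.map _) fun x hx => ?_
  obtain ⟨d, -, rfl⟩ := List.mem_map.1 hx
  exact dist_nonneg

namespace Parallelogram

variable (P : Parallelogram)

/-- The basis of the plane formed by the sides of the parallelogram. -/
noncomputable def sides : Module.Basis (Fin 2) ℝ Plane :=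
  basisOfLinearIndependentOfCardEqFinrank P.linearIndependent (by simp)

lemma sides_zero : P.sides 0 = P.long := by simp [sides]

lemma sides_one : P.sides 1 = P.short := by simp [sides]

lemma coord_add_coord (x : Plane) :
    P.sides.coord 0 x • P.long + P.sides.coord 1 x • P.short = x := by
  have := P.sides.sum_repr x
  rwa [Fin.sum_univ_two, sides_zero, sides_one] at this

lemma coord_zero_combination (α β : ℝ) : P.sides.coord 0 (α • P.long + β • P.short) = α := by
  rw [← sides_zero, ← sides_one]
  simp

lemma coord_one_combination (α β : ℝ) : P.sides.coord 1 (α • P.long + β • P.short) = β := by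
  rw [← sides_zero, ← sides_one]
  simp

lemma mem_scaledTranslate_iff {L B r : ℝ} (hr : 0 < r) (x : Plane) :
    x ∈ P.scaledTranslate r (L • P.long + B • P.short - r • P.corner) ↔
      P.sides.coord 0 x ∈ Set.Icc L (L + r) ∧ P.sides.coord 1 x ∈ Set.Icc B (B + r) := by
  constructor
  · rintro ⟨_, ⟨α, hα, β, hβ, rfl⟩, rfl⟩
    have : r • (P.corner + α • P.long + β • P.short) +
        (L • P.long + B • P.short - r • P.corner) =
        (L + r * α) • P.long + (B + r * β) • P.short := by module
    dsimp only
    rw [this, coord_zero_combination, coord_one_combination]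
    obtain ⟨h1, h2⟩ := hα
    obtain ⟨h3, h4⟩ := hβ
    exact ⟨⟨by nlinarith, by nlinarith⟩, ⟨by nlinarith, by nlinarith⟩⟩
  · rintro ⟨⟨h1, h2⟩, ⟨h3, h4⟩⟩
    have key : ∀ u v : ℝ, u ≤ v → v ≤ u + r → (v - u) / r ∈ Set.Icc (0 : ℝ) 1 := fun u v h h' =>
      ⟨div_nonneg (by linarith) hr.le, (div_le_one hr).2 (by linarith)⟩
    refine ⟨_, ⟨_, key _ _ h1 h2, _, key _ _ h3 h4, rfl⟩, ?_⟩
    dsimp only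
    conv_rhs => rw [← P.coord_add_coord x]
    match_scalars <;> field_simp <;> ring

lemma coord_mem_Ioo_of_mem_interior (i : Fin 2) {T : Set Plane} {u v : ℝ}
    (hT : ∀ x ∈ T, P.sides.coord i x ∈ Set.Icc u v) {x : Plane} (hx : x ∈ interior T) :
    P.sides.coord i x ∈ Set.Ioo u v := by
  have hs : Function.Surjective (P.sides.coord i) := fun y => ⟨y • P.sides i, by simp⟩
  have ho := (P.sides.coord i).isOpenMap_of_finiteDimensional hs
  rw [← interior_Icc]
  have hsub : P.sides.coord i '' interior T ⊆ Set.Icc u v := by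
    rintro _ ⟨y, hy, rfl⟩
    exact hT y (interior_subset hy)
  exact interior_maximal hsub (ho _ isOpen_interior) ⟨x, hx, rfl⟩

variable {P} {S : Finset Plane}

lemma delaunayGraph_adj_of_squareAdj {a b : S}
    (h : SquareDelaunay.SquareAdj (fun p : S => P.sides.coord 0 (p : Plane))
      (fun p : S => P.sides.coord 1 (p : Plane)) a b) : (P.delaunayGraph S).Adj a b := by
  obtain ⟨hne, L, B, r, hr, ⟨a1, a2, a3, a4⟩, ⟨b1, b2, b3, b4⟩, he⟩ := h
  have hint : ∀ c ∈ S, c ∉ interior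
      (P.scaledTranslate r (L • P.long + B • P.short - r • P.corner)) := by
    intro c hc hci
    have h0 := P.coord_mem_Ioo_of_mem_interior 0
      (fun x hx => ((P.mem_scaledTranslate_iff hr x).1 hx).1) hci
    have h1 := P.coord_mem_Ioo_of_mem_interior 1
      (fun x hx => ((P.mem_scaledTranslate_iff hr x).1 hx).2) hci
    exact he ⟨c, hc⟩ h0.1 h0.2 h1.1 h1.2
  refine ⟨hne, r, hr, L • P.long + B • P.short - r • P.corner, ⟨subset_closure ?_, hint a a.2⟩,
    ⟨subset_closure ?_, hint b b.2⟩, hint⟩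
  · exact (P.mem_scaledTranslate_iff hr a).2 ⟨⟨a1, a2⟩, ⟨a3, a4⟩⟩
  · exact (P.mem_scaledTranslate_iff hr b).2 ⟨⟨b1, b2⟩, ⟨b3, b4⟩⟩

lemma GeneralPosition.coord_zero_injective (hS : P.GeneralPosition S) :
    Function.Injective (fun p : S => P.sides.coord 0 (p : Plane)) := by
  intro a b hab
  by_contra hne
  refine (hS.2 a a.2 b b.2 (fun h => hne (Subtype.ext h))
    (P.sides.coord 1 ((b : Plane) - a))).2 ?_
  have h0 : P.sides.coord 0 ((b : Plane) - a) = 0 := by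
    rw [map_sub]
    exact sub_eq_zero.2 hab.symm
  conv_lhs => rw [← P.coord_add_coord ((b : Plane) - a), h0, zero_smul, zero_add]

lemma GeneralPosition.coord_one_injective (hS : P.GeneralPosition S) :
    Function.Injective (fun p : S => P.sides.coord 1 (p : Plane)) := by
  intro a b hab
  by_contra hne
  refine (hS.2 a a.2 b b.2 (fun h => hne (Subtype.ext h))
    (P.sides.coord 0 ((b : Plane) - a))).1 ?_
  have h0 : P.sides.coord 1 ((b : Plane) - a) = 0 := by
    rw [map_sub]
    exact sub_eq_zero.2 hab.symm
  conv_lhs => rw [← P.coord_add_coord ((b : Plane) - a), h0, zero_smul, add_zero]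

lemma norm_long_pos : 0 < ‖P.long‖ :=
  norm_pos_iff.2 (P.linearIndependent.ne_zero 0)

lemma norm_short_pos : 0 < ‖P.short‖ :=
  norm_pos_iff.2 (P.linearIndependent.ne_zero 1)

variable (P) in
/-- The length of the longer diagonal. -/
noncomputable def diagonal : ℝ := max ‖P.long + P.short‖ ‖P.long - P.short‖

lemma norm_long_le_diagonal : ‖P.long‖ ≤ P.diagonal := by
  have h1 : ‖P.long + P.short‖ ≤ P.diagonal := le_max_left _ _
  have h2 : ‖P.long - P.short‖ ≤ P.diagonal := le_max_right _ _
  have h3 : ‖(2 : ℝ) • P.long‖ ≤ ‖P.long + P.short‖ + ‖P.long - P.short‖ := by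
    have : (2 : ℝ) • P.long = (P.long + P.short) + (P.long - P.short) := by module
    rw [this]
    exact norm_add_le _ _
  rw [norm_smul, Real.norm_ofNat] at h3
  linarith

lemma norm_combination_le_diagonal (x y : ℝ) :
    ‖x • P.long + y • P.short‖ ≤ P.diagonal * max |x| |y| := by
  have h1 : ‖P.long + P.short‖ ≤ P.diagonal := le_max_left _ _
  have h2 : ‖P.long - P.short‖ ≤ P.diagonal := le_max_right _ _
  have e : x • P.long + y • P.short =
      ((x + y) / 2) • (P.long + P.short) + ((x - y) / 2) • (P.long - P.short) := by module
  have hm : |(x + y) / 2| + |(x - y) / 2| ≤ max |x| |y| := by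
    rw [abs_div, abs_div, abs_two]
    rcases abs_cases (x + y) with h | h <;> rcases abs_cases (x - y) with h' | h' <;>
      linarith [le_max_left |x| |y|, le_max_right |x| |y|, le_abs_self x, neg_le_abs x,
        le_abs_self y, neg_le_abs y]
  have hd : 0 ≤ P.diagonal := (norm_nonneg _).trans h1
  calc ‖x • P.long + y • P.short‖
      ≤ |(x + y) / 2| * ‖P.long + P.short‖ + |(x - y) / 2| * ‖P.long - P.short‖ := by
        rw [e, ← Real.norm_eq_abs, ← Real.norm_eq_abs, ← norm_smul, ← norm_smul]
        exact norm_add_le _ _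
    _ ≤ |(x + y) / 2| * P.diagonal + |(x - y) / 2| * P.diagonal := by gcongr
    _ ≤ P.diagonal * max |x| |y| := by
        rw [← add_mul, mul_comm]
        gcongr

lemma norm_combination_le_add (x y : ℝ) :
    ‖x • P.long + y • P.short‖ ≤ ‖P.long‖ * (|x| + |y|) := by
  calc ‖x • P.long + y • P.short‖ ≤ |x| * ‖P.long‖ + |y| * ‖P.short‖ := by
        rw [← Real.norm_eq_abs, ← Real.norm_eq_abs, ← norm_smul, ← norm_smul]
        exact norm_add_le _ _
    _ ≤ |x| * ‖P.long‖ + |y| * ‖P.long‖ := by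
        gcongr
        exact P.norm_short_le
    _ = ‖P.long‖ * (|x| + |y|) := by ring

lemma dist_eq_norm_combination (a b : Plane) : dist a b =
    ‖(P.sides.coord 0 a - P.sides.coord 0 b) • P.long +
      (P.sides.coord 1 a - P.sides.coord 1 b) • P.short‖ := by
  rw [dist_eq_norm, ← map_sub, ← map_sub, coord_add_coord]

lemma exists_walk_of_joinedWithin {a b : S} {t : ℝ}
    (h : SquareDelaunay.JoinedWithin (fun p : S => P.sides.coord 0 (p : Plane))
      (fun p : S => P.sides.coord 1 (p : Plane)) (P.diagonal / ‖P.long‖) a b t) :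
    ∃ p : (P.delaunayGraph S).Walk a b, euclideanLength p ≤ ‖P.long‖ * t := by
  induction h with
  | refl i t h0 => exact ⟨.nil, by simpa [euclideanLength] using mul_nonneg (norm_nonneg _) h0⟩
  | cons i j k s t hadj _ hle ih =>
    obtain ⟨p, hp⟩ := ih
    refine ⟨.cons (delaunayGraph_adj_of_squareAdj hadj) p, ?_⟩
    have hedge : dist (i : Plane) j ≤ ‖P.long‖ * SquareDelaunay.edgeWeight
        (fun p : S => P.sides.coord 0 (p : Plane)) (fun p : S => P.sides.coord 1 (p : Plane))
        (P.diagonal / ‖P.long‖) i j := by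
      rw [P.dist_eq_norm_combination, SquareDelaunay.edgeWeight, mul_min_of_nonneg _ _
        (norm_nonneg _), ← mul_assoc, mul_div_cancel₀ _ P.norm_long_pos.ne']
      exact le_min (norm_combination_le_add _ _) (norm_combination_le_diagonal _ _)
    have := mul_le_mul_of_nonneg_left hle P.norm_long_pos.le
    rw [mul_add] at this
    calc _ = dist (i : Plane) j + euclideanLength p := by simp [euclideanLength]
      _ ≤ _ := by linarith

lemma exists_isPath_le_detour (hS : P.GeneralPosition S) (a b : S) :
    ∃ p : (P.delaunayGraph S).Walk a b, p.IsPath ∧ euclideanLength p ≤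
      ‖P.long‖ * SquareDelaunay.detour (fun p : S => P.sides.coord 0 (p : Plane))
        (fun p : S => P.sides.coord 1 (p : Plane)) (P.diagonal / ‖P.long‖) a b := by
  obtain ⟨p, hp⟩ := exists_walk_of_joinedWithin (SquareDelaunay.joinedWithin_detour
    hS.coord_zero_injective hS.coord_one_injective
    ((one_le_div P.norm_long_pos).2 P.norm_long_le_diagonal) a b)
  exact ⟨p.bypass, p.bypass_isPath, (euclideanLength_bypass_le p).trans hp⟩

lemma sin_nonObtuseAngle : Real.sin P.nonObtuseAngle =
    Real.sin (InnerProductGeometry.angle P.long P.short) := by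
  rcases min_choice (InnerProductGeometry.angle P.long P.short)
    (Real.pi - InnerProductGeometry.angle P.long P.short) with h | h
  · rw [nonObtuseAngle, h]
  · rw [nonObtuseAngle, h, Real.sin_pi_sub]

lemma sin_nonObtuseAngle_pos : 0 < Real.sin P.nonObtuseAngle := by
  rw [sin_nonObtuseAngle]
  refine lt_of_le_of_ne (InnerProductGeometry.sin_angle_nonneg _ _) fun h => ?_
  have hl : P.long ≠ 0 := P.linearIndependent.ne_zero 0
  have hli := (LinearIndependent.pair_iff.1 P.linearIndependent)
  have key (r : ℝ) (hr : P.short = r • P.long) : False := by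
    have := hli r (-1) (by rw [hr]; module)
    norm_num at this
  rcases InnerProductGeometry.sin_eq_zero_iff_angle_eq_zero_or_angle_eq_pi.1 h.symm with h' | h'
  · obtain ⟨-, r, -, hr⟩ := InnerProductGeometry.angle_eq_zero_iff.1 h'
    exact key r hr
  · obtain ⟨-, r, -, hr⟩ := InnerProductGeometry.angle_eq_pi_iff.1 h'
    exact key r hr

lemma cos_nonObtuseAngle : Real.cos P.nonObtuseAngle =
    |Real.cos (InnerProductGeometry.angle P.long P.short)| := by
  have h0 := InnerProductGeometry.angle_nonneg P.long P.short
  have h1 := InnerProductGeometry.angle_le_pi P.long P.short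
  rcases le_total (InnerProductGeometry.angle P.long P.short)
    (Real.pi - InnerProductGeometry.angle P.long P.short) with h | h
  · rw [nonObtuseAngle, min_eq_left h, abs_of_nonneg]
    exact Real.cos_nonneg_of_mem_Icc ⟨by linarith, by linarith⟩
  · rw [nonObtuseAngle, min_eq_right h, Real.cos_pi_sub, abs_of_nonpos]
    exact Real.cos_nonpos_of_pi_div_two_le_of_le (by linarith) (by linarith)

lemma norm_sq_combination (x y : ℝ) : ‖x • P.long + y • P.short‖ ^ 2 =
    (x * ‖P.long‖) ^ 2 + 2 * (x * y) * (‖P.long‖ * ‖P.short‖ *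
      Real.cos (InnerProductGeometry.angle P.long P.short)) + (y * ‖P.short‖) ^ 2 := by
  rw [norm_add_sq_real, real_inner_smul_left, real_inner_smul_right, norm_smul, norm_smul,
    Real.norm_eq_abs, Real.norm_eq_abs, mul_pow, mul_pow, sq_abs, sq_abs,
    ← InnerProductGeometry.cos_angle_mul_norm_mul_norm]
  ring

lemma diagonal_eq : P.diagonal = ‖P.short‖ * √(1 + P.aspectRatio ^ 2 +
    2 * P.aspectRatio * Real.cos P.nonObtuseAngle) := by
  have hs := P.norm_short_pos
  have hl : ‖P.long‖ = P.aspectRatio * ‖P.short‖ := by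
    rw [aspectRatio, div_mul_cancel₀ _ hs.ne']
  have h1 := P.norm_sq_combination 1 1
  have h2 := P.norm_sq_combination 1 (-1)
  simp only [one_smul, neg_smul, ← sub_eq_add_neg] at h1 h2
  have hd : 0 ≤ P.diagonal := (norm_nonneg _).trans (le_max_left _ _)
  have hls : 0 < ‖P.long‖ * ‖P.short‖ := mul_pos P.norm_long_pos hs
  have hd2 : P.diagonal ^ 2 = ‖P.short‖ ^ 2 * (1 + P.aspectRatio ^ 2 +
      2 * P.aspectRatio * Real.cos P.nonObtuseAngle) := by
    rw [cos_nonObtuseAngle, diagonal]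
    rcases le_total 0 (Real.cos (InnerProductGeometry.angle P.long P.short)) with h | h
    · rw [max_eq_left, h1, abs_of_nonneg h, hl]
      · ring
      · rw [← sq_le_sq₀ (norm_nonneg _) (norm_nonneg _), h1, h2]
        linarith [mul_nonneg hls.le h]
    · rw [max_eq_right, h2, abs_of_nonpos h, hl]
      · ring
      · rw [← sq_le_sq₀ (norm_nonneg _) (norm_nonneg _), h1, h2]
        linarith [mul_nonneg hls.le (neg_nonneg.2 h)]
  rw [← Real.sqrt_sq hd, hd2, Real.sqrt_mul (sq_nonneg _), Real.sqrt_sq hs.le]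

/-- The optimization over the direction: the Cauchy–Schwarz inequality for a Gram form. -/
lemma detour_le_of_aspect {A c σ E x y : ℝ} (hA : 1 ≤ A) (hc : 0 ≤ c) (hσ : 0 < σ)
    (hσc : σ ^ 2 + c ^ 2 = 1) (hE : 0 ≤ E) (hE2 : E ^ 2 = 1 + A ^ 2 + 2 * A * c) :
    (A + E) * max |x| |y| + A * min |x| |y| ≤
      √2 * √(E ^ 2 + (A + c) * E) / σ * √((x * A) ^ 2 - 2 * |x * y| * (A * c) + y ^ 2) := by
  have hmm : max |x| |y| * min |x| |y| = |x * y| := by rw [max_mul_min, abs_mul]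
  have hM : 0 ≤ max |x| |y| := (abs_nonneg x).trans (le_max_left _ _)
  have hm : 0 ≤ min |x| |y| := le_min (abs_nonneg x) (abs_nonneg y)
  have hQ : max |x| |y| ^ 2 + (A * min |x| |y|) ^ 2 ≤ (x * A) ^ 2 + y ^ 2 := by
    have hA2 : 1 ≤ A ^ 2 := by nlinarith
    rcases le_total |x| |y| with h | h
    · rw [max_eq_right h, min_eq_left h, mul_pow, sq_abs, sq_abs]
      linarith
    · rw [max_eq_left h, min_eq_right h, mul_pow, sq_abs, sq_abs]
      nlinarith [sq_le_sq.2 h]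
  set M := max |x| |y|
  set m := min |x| |y|
  rw [div_mul_eq_mul_div, le_div_iff₀ hσ, ← Real.sqrt_mul (by norm_num),
    ← Real.sqrt_mul (by positivity)]
  refine Real.le_sqrt_of_sq_le ?_
  have hK : 2 * (E ^ 2 + (A + c) * E) = (A + E) ^ 2 + 2 * c * (A + E) + 1 := by nlinarith
  have hσ2 : σ ^ 2 = 1 - c ^ 2 := by linarith
  rw [hK]
  calc (((A + E) * M + A * m) * σ) ^ 2
      ≤ ((A + E) ^ 2 + 2 * c * (A + E) + 1) * (M ^ 2 + (A * m) ^ 2 - 2 * (M * m) * (A * c)) := by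
        rw [mul_pow, hσ2]
        nlinarith [sq_nonneg ((1 + c * (A + E)) * M - (A + E + c) * (A * m))]
    _ ≤ _ := by
        gcongr ?_ * ?_
        rw [hmm]
        linarith

lemma one_le_aspectRatio : 1 ≤ P.aspectRatio :=
  (one_le_div P.norm_short_pos).2 P.norm_short_le

lemma norm_short_mul_sqrt_le_norm_combination (x y : ℝ) :
    ‖P.short‖ * √((x * P.aspectRatio) ^ 2 -
      2 * |x * y| * (P.aspectRatio * Real.cos P.nonObtuseAngle) + y ^ 2) ≤
      ‖x • P.long + y • P.short‖ := by
  have hs := P.norm_short_pos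
  have hl : ‖P.long‖ = P.aspectRatio * ‖P.short‖ := by
    rw [aspectRatio, div_mul_cancel₀ _ hs.ne']
  rw [← Real.sqrt_sq (norm_nonneg (x • P.long + y • P.short)), norm_sq_combination, hl]
  nth_rewrite 1 [← Real.sqrt_sq hs.le]
  rw [← Real.sqrt_mul (sq_nonneg _), cos_nonObtuseAngle]
  refine Real.sqrt_le_sqrt ?_
  have h := neg_abs_le (x * y * Real.cos (InnerProductGeometry.angle P.long P.short))
  rw [abs_mul] at h
  have h2 : 0 ≤ P.aspectRatio * ‖P.short‖ ^ 2 :=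
    mul_nonneg (zero_le_one.trans P.one_le_aspectRatio) (sq_nonneg _)
  nlinarith [mul_le_mul_of_nonneg_left h h2]

lemma mul_detour_le (a b : S) {A θ₀ h : ℝ} (hA : A = P.aspectRatio)
    (hθ₀ : θ₀ = P.nonObtuseAngle)
    (hh : h = √2 * √(1 + A ^ 2 + 2 * A * Real.cos θ₀ +
        (A + Real.cos θ₀) * √(1 + A ^ 2 + 2 * A * Real.cos θ₀)) / Real.sin θ₀) :
    ‖P.long‖ * SquareDelaunay.detour (fun p : S => P.sides.coord 0 (p : Plane))
        (fun p : S => P.sides.coord 1 (p : Plane)) (P.diagonal / ‖P.long‖) a b ≤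
      h * dist (a : Plane) b := by
  have hs := P.norm_short_pos
  have hl : ‖P.long‖ = A * ‖P.short‖ := by
    rw [hA, aspectRatio, div_mul_cancel₀ _ hs.ne']
  have hA1 : 1 ≤ A := hA ▸ P.one_le_aspectRatio
  have hσ : 0 < Real.sin θ₀ := hθ₀ ▸ P.sin_nonObtuseAngle_pos
  have hc : 0 ≤ Real.cos θ₀ := by
    rw [hθ₀, cos_nonObtuseAngle]
    exact abs_nonneg _
  have hE2 : √(1 + A ^ 2 + 2 * A * Real.cos θ₀) ^ 2 = 1 + A ^ 2 + 2 * A * Real.cos θ₀ :=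
    Real.sq_sqrt (by positivity)
  have hD : P.diagonal = ‖P.short‖ * √(1 + A ^ 2 + 2 * A * Real.cos θ₀) := by
    rw [diagonal_eq, hA, hθ₀]
  have hh0 : 0 ≤ h := by
    rw [hh]
    positivity
  set x := P.sides.coord 0 (a : Plane) - P.sides.coord 0 (b : Plane) with hx
  set y := P.sides.coord 1 (a : Plane) - P.sides.coord 1 (b : Plane) with hy
  have h1 := detour_le_of_aspect (x := x) (y := y) hA1 hc hσ (Real.sin_sq_add_cos_sq θ₀)
    (Real.sqrt_nonneg _) hE2
  rw [hE2, ← hh] at h1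
  have h2 := P.norm_short_mul_sqrt_le_norm_combination x y
  rw [← hA, ← hθ₀] at h2
  rw [P.dist_eq_norm_combination, ← hx, ← hy, SquareDelaunay.detour, ← hx, ← hy]
  calc _ = (‖P.long‖ + P.diagonal) * max |x| |y| + ‖P.long‖ * min |x| |y| := by
        have := P.norm_long_pos.ne'
        field_simp
    _ = ‖P.short‖ * ((A + √(1 + A ^ 2 + 2 * A * Real.cos θ₀)) * max |x| |y| +
          A * min |x| |y|) := by
        rw [hD, hl]
        ring
    _ ≤ ‖P.short‖ * (h * √((x * A) ^ 2 - 2 * |x * y| * (A * Real.cos θ₀) + y ^ 2)) := by gcongr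
    _ = h * (‖P.short‖ * √((x * A) ^ 2 - 2 * |x * y| * (A * Real.cos θ₀) + y ^ 2)) := by ring
    _ ≤ _ := by gcongr

end Parallelogram

lemma spanningRatio_le_of_isSpanner {S : Finset Plane} {G : SimpleGraph S} {c : ℝ} (hc : 0 ≤ c)
    (h : IsSpanner G c) : spanningRatio G ≤ ENNReal.ofReal c :=
  iInf₂_le c.toNNReal (by rwa [Real.coe_toNNReal c hc])

theorem mainTheorem2 (P : Parallelogram) (S : Finset Plane) (hS : P.GeneralPosition S)
    (A θ₀ h : ℝ) (hA : A = P.aspectRatio) (hθ₀ : θ₀ = P.nonObtuseAngle)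
    (hh : h = √2 * √(1 + A ^ 2 + 2 * A * Real.cos θ₀ +
        (A + Real.cos θ₀) * √(1 + A ^ 2 + 2 * A * Real.cos θ₀)) / Real.sin θ₀) :
    IsSpanner (P.delaunayGraph S) h ∧
      spanningRatio (P.delaunayGraph S) ≤ ENNReal.ofReal h := by
  have hspan : IsSpanner (P.delaunayGraph S) h := by
    intro a b
    obtain ⟨p, hp, hle⟩ := Parallelogram.exists_isPath_le_detour hS a b
    exact ⟨p, hp, hle.trans (Parallelogram.mul_detour_le a b hA hθ₀ hh)⟩
  refine ⟨hspan, spanningRatio_le_of_isSpanner ?_ hspan⟩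
  have hσ : 0 < Real.sin θ₀ := hθ₀ ▸ P.sin_nonObtuseAngle_pos
  rw [hh]
  positivity
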